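/- Let $d\ge 0$ be an integer and write elements of $\mathbb{R}^{2d}$ as $z=(x,\omega)$ with $x,\omega\in\mathbb{R}^d$. On $L^2(\mathbb{R}^d)$ let $\pi(z)\psi(t)=e^{2\pi i\omega\cdot t}\psi(t-x)$, and for a bounded operator $A$ on $L^2(\mathbb{R}^d)$ let $\alpha_z(A)=\pi(z)A\pi(z)^*$. Let $\mathcal{T}^1$ be the space of trace class operators on $L^2(\mathbb{R}^d)$, i.e. of the operators with summable singular values. For $S\in\mathcal{T}^1$ let $$\mathcal{F}_WS(z)=e^{-\pi i x\cdot\omega}\,\mathrm{tr}(\pi(-z)S),\qquad z\in\mathbb{R}^{2d},$$ be its Fourier-Wigner transform. For $f\in L^1(\mathbb{R}^{2d})$ let $$\mathcal{F}_\sigma f(z)=\int_{\mathbb{R}^{2d}}f(z')e^{-2\pi i\sigma(z,z')}\,dz',\qquad \sigma(x,\omega;x',\omega')=\omega\cdot x'-\omega'\cdot x,$$ be its symplectic Fourier transform. The spectrum of $f$ is the closed support of $\mathcal{F}_\sigma f$, and the spectrum of a family of integrable functions is the closure of the union of the spectra of its members (equivalently, the closure of the complement of the set of common zeros of their symplectic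 Fourier transforms). The Arveson spectrum $\mathrm{Spec}_\alpha(S)$ of $S\in\mathcal{T}^1$ is the spectrum of the family of functions $z\mapsto\rho(\alpha_z(S))$, where $\rho$ runs through the predual of $B(L^2(\mathbb{R}^d))$, that is, through the functionals $\rho(A)=\mathrm{tr}(T^*A)$ with $T\in\mathcal{T}^1$. **Proposition.** Let $S\in\mathcal{T}^1$. Then each of the functions $z\mapsto\mathrm{tr}(T^*\alpha_z(S))$, $T\in\mathcal{T}^1$, is integrable on $\mathbb{R}^{2d}$ (so that $\mathrm{Spec}_\alpha(S)$ is well defined), and $$\mathrm{Spec}_\alpha(S)=\overline{\mathbb{R}^{2d}\setminus\{z\in\mathbb{R}^{2d}:\mathcal{F}_WS(-z)=0\}}.$$ -/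

import Mathlib

open MeasureTheory

noncomputable section

namespace QHA

/-- The Hilbert space `L²(ℝᵈ)` of complex-valued functions, with respect to Lebesgue measure. -/
abbrev L2 (d : ℕ) : Type := Lp ℂ 2 (volume : Measure (EuclideanSpace ℝ (Fin d)))

/-- The phase space `ℝ²ᵈ = ℝᵈ × ℝᵈ`; its elements are `z = (x, ω)`. -/
abbrev Phase (d : ℕ) : Type := EuclideanSpace ℝ (Fin d) × EuclideanSpace ℝ (Fin d)

/-- The standard symplectic form `σ(x₁, ω₁; x₂, ω₂) = ω₁ · x₂ - ω₂ · x₁`. -/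
def symp {d : ℕ} (z w : Phase d) : ℝ := inner ℝ z.2 w.1 - inner ℝ w.2 z.1

/-- The function `M_ω T_x ψ`, that is, `t ↦ exp(2πi ω · t) ψ(t - x)`, where `z = (x, ω)`. -/
def shiftFun {d : ℕ} (z : Phase d) (ψ : EuclideanSpace ℝ (Fin d) → ℂ)
    (t : EuclideanSpace ℝ (Fin d)) : ℂ :=
  Complex.exp (2 * Real.pi * Complex.I * ((inner ℝ z.2 t : ℝ) : ℂ)) * ψ (t - z.1)

theorem norm_shiftFun {d : ℕ} (z : Phase d) (ψ : EuclideanSpace ℝ (Fin d) → ℂ)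
    (t : EuclideanSpace ℝ (Fin d)) : ‖shiftFun z ψ t‖ = ‖ψ (t - z.1)‖ := by
  have h : 2 * (Real.pi : ℂ) * Complex.I * ((inner ℝ z.2 t : ℝ) : ℂ)
      = ((2 * Real.pi * inner ℝ z.2 t : ℝ) : ℂ) * Complex.I := by
    push_cast
    ring
  rw [shiftFun, norm_mul, h, Complex.norm_exp_ofReal_mul_I, one_mul]

theorem memLp_shiftFun {d : ℕ} (z : Phase d) (ψ : L2 d) :
    MemLp (shiftFun z ψ) 2 (volume : Measure (EuclideanSpace ℝ (Fin d))) := by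
  have hψ : MemLp (fun t => ψ (t - z.1)) 2 (volume : Measure (EuclideanSpace ℝ (Fin d))) :=
    (Lp.memLp ψ).comp_measurePreserving (measurePreserving_sub_right volume z.1)
  have hc : Continuous fun t : EuclideanSpace ℝ (Fin d) =>
      Complex.exp (2 * Real.pi * Complex.I * ((inner ℝ z.2 t : ℝ) : ℂ)) := by
    fun_prop
  refine hψ.of_le (hc.aestronglyMeasurable.mul hψ.aestronglyMeasurable) ?_
  exact Filter.Eventually.of_forall fun t => (norm_shiftFun z ψ t).le

/-- The time-frequency shift `π(z) = M_ω T_x` on `L²(ℝᵈ)`, an isometry. -/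
def tfShiftIsometry {d : ℕ} (z : Phase d) : L2 d →ₗᵢ[ℂ] L2 d where
  toFun ψ := (memLp_shiftFun z ψ).toLp (shiftFun z ψ)
  map_add' ψ φ := by
    rw [← MemLp.toLp_add, MemLp.toLp_eq_toLp_iff]
    have h := (measurePreserving_sub_right (volume : Measure (EuclideanSpace ℝ (Fin d)))
      z.1).quasiMeasurePreserving.ae (Lp.coeFn_add ψ φ)
    filter_upwards [h] with t ht
    simp only [shiftFun, Pi.add_apply] at ht ⊢
    rw [ht, mul_add]
  map_smul' c ψ := by
    rw [RingHom.id_apply, ← MemLp.toLp_const_smul, MemLp.toLp_eq_toLp_iff]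
    have h := (measurePreserving_sub_right (volume : Measure (EuclideanSpace ℝ (Fin d)))
      z.1).quasiMeasurePreserving.ae (Lp.coeFn_smul c ψ)
    filter_upwards [h] with t ht
    simp only [shiftFun, Pi.smul_apply, smul_eq_mul] at ht ⊢
    rw [ht, mul_left_comm]
  norm_map' ψ := by
    change ‖(memLp_shiftFun z ψ).toLp (shiftFun z ψ)‖ = ‖ψ‖
    rw [Lp.norm_toLp, Lp.norm_def]
    congr 1
    rw [← eLpNorm_comp_measurePreserving (Lp.aestronglyMeasurable ψ)
      (measurePreserving_sub_right (volume : Measure (EuclideanSpace ℝ (Fin d))) z.1)]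
    exact eLpNorm_congr_norm_ae (Filter.Eventually.of_forall fun t => norm_shiftFun z ψ t)

/-- The time-frequency shift `π(z)` as a bounded operator on `L²(ℝᵈ)`. -/
def tfShift {d : ℕ} (z : Phase d) : L2 d →L[ℂ] L2 d :=
  (tfShiftIsometry z).toContinuousLinearMap

/-- The shift of operators `α_z(A) = π(z) A π(z)*`. -/
def opShift {d : ℕ} (z : Phase d) (A : L2 d →L[ℂ] L2 d) : L2 d →L[ℂ] L2 d :=
  tfShift z ∘L A ∘L ContinuousLinearMap.adjoint (tfShift z)

section TraceClass

variable {H : Type*} [NormedAddCommGroup H] [InnerProductSpace ℂ H] [CompleteSpace H]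

/-- Trace class operators: those with a singular value decomposition
`T ζ = ∑ᵢ sᵢ ⟨ζ, φᵢ⟩ ψᵢ` (`ψ`, `φ` orthonormal systems) whose nonzero singular values `sᵢ > 0` are
summable. Summability makes the index set at most countable; it may be finite or empty. -/
def IsTraceClass (T : H →L[ℂ] H) : Prop :=
  ∃ (ι : Type) (s : ι → ℝ) (ψ φ : ι → H),
    (∀ i, 0 < s i) ∧ Summable s ∧ Orthonormal ℂ ψ ∧ Orthonormal ℂ φ ∧
      ∀ ζ : H, HasSum (fun i => ((s i : ℂ) * inner ℂ (φ i) ζ) • ψ i) (T ζ)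

/-- The index set of a chosen orthonormal basis of `H`. -/
def onbIndex (H : Type*) [NormedAddCommGroup H] [InnerProductSpace ℂ H] [CompleteSpace H] : Set H :=
  (exists_hilbertBasis ℂ H).choose

/-- A chosen orthonormal basis of `H`. -/
def onb (H : Type*) [NormedAddCommGroup H] [InnerProductSpace ℂ H] [CompleteSpace H] :
    HilbertBasis (onbIndex H) ℂ H :=
  (exists_hilbertBasis ℂ H).choose_spec.choose

/-- The trace `tr(T) = ∑ₙ ⟨T eₙ, eₙ⟩` for an orthonormal basis `(eₙ)`. Mathlib's inner product is
antilinear in its first argument. For trace class `T` the sum converges absolutely and does not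
depend on the basis. -/
def tr (T : H →L[ℂ] H) : ℂ := ∑' n, inner ℂ (onb H n) (T (onb H n))

end TraceClass

/-- The symplectic Fourier transform `F_σ f(z) = ∫ f(z') exp(-2πi σ(z, z')) dz'`. -/
def symplecticFourier {d : ℕ} (f : Phase d → ℂ) (z : Phase d) : ℂ :=
  ∫ w, f w * Complex.exp (-(2 * Real.pi * Complex.I * ((symp z w : ℝ) : ℂ)))

/-- The Fourier-Wigner transform `F_W S(z) = exp(-πi x · ω) tr(π(-z) S)`, where `z = (x, ω)`. -/
def fourierWigner {d : ℕ} (S : L2 d →L[ℂ] L2 d) (z : Phase d) : ℂ :=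
  Complex.exp (-(Real.pi * Complex.I * ((inner ℝ z.1 z.2 : ℝ) : ℂ))) * tr (tfShift (-z) ∘L S)

/-- The spectrum of an integrable function: the closed support of its symplectic Fourier
transform. -/
def functionSpectrum {d : ℕ} (f : Phase d → ℂ) : Set (Phase d) :=
  closure {z | symplecticFourier f z ≠ 0}

/-- The spectrum of a family of integrable functions: the smallest closed set that contains the
spectrum of each member, i.e. the closure of the complement of the set of common zeros of the
symplectic Fourier transforms. -/
def familySpectrum {d : ℕ} (F : Set (Phase d → ℂ)) : Set (Phase d) :=
  closure (⋃ f ∈ F, functionSpectrum f)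

/-- The Arveson spectrum of `x ∈ X` for a group `U` of transformations of `X` indexed by `ℝ²ᵈ`:
the spectrum of the family of functions `z ↦ ρ(U_z x)`, where `ρ` runs through the given set of
functionals, the predual of `X`. -/
def arvesonSpectrum {d : ℕ} {X : Type*} (predual : Set (X → ℂ)) (U : Phase d → X → X) (x : X) :
    Set (Phase d) :=
  familySpectrum {f | ∃ ρ ∈ predual, f = fun z => ρ (U z x)}

/-- The predual of `B(H)`: the functionals `A ↦ tr(T* A)` with `T` trace class. -/
def traceFunctionals (H : Type*) [NormedAddCommGroup H] [InnerProductSpace ℂ H]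
    [CompleteSpace H] : Set ((H →L[ℂ] H) → ℂ) :=
  {ρ | ∃ T : H →L[ℂ] H, IsTraceClass T ∧
    ρ = fun A => tr (ContinuousLinearMap.adjoint T ∘L A)}

/-- The spectrum `Spec_α(A)` of an operator `A` on `L²(ℝᵈ)` for the shift `α`. -/
def specAlpha {d : ℕ} (A : L2 d →L[ℂ] L2 d) : Set (Phase d) :=
  arvesonSpectrum (traceFunctionals (L2 d)) opShift A

end QHA

end

/-! Everything rests on one identity for trace class `S`, `T`: the symplectic Fourier transform of
`w ↦ tr(T* α_w(S))` at `z` is `conj(tr(π(z)T)) * tr(π(z)S)` (`symplecticFourier_traceFunctional`).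
Hence every zero of `tr(π(z)S)` is a common zero of the family. Conversely, for each `z` some rank
one `T` has `tr(π(z)T) ≠ 0`, so there are no other common zeros. Up to a nonvanishing phase,
`tr(π(z)S)` is the Fourier-Wigner transform at `-z`.

Singular value expansions reduce the identity to rank one operators, where the function is a product
of two matrix coefficients of `π`. The commutation relation absorbs the symplectic character into
the vectors, and Moyal's identity (`integral_moyal`) evaluates the integral. The resulting double
series converges absolutely in `L¹`, which gives integrability and the interchange of sum and
integral. -/

open MeasureTheory
open scoped FourierTransform ContDiff

noncomputable section

namespace QHA

/-! ### Plancherel's theorem for Fourier integrals -/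

section Plancherel

variable {V : Type*} [NormedAddCommGroup V] [InnerProductSpace ℝ V] [FiniteDimensional ℝ V]
  [MeasurableSpace V] [BorelSpace V]

/-- For integrable square integrable functions the Fourier integral is a representative of the
Fourier transform on `L²`. -/
theorem fourier_ae_eq_fourier_toLp {f : V → ℂ} (h1 : Integrable f) (h2 : MemLp f 2) :
    𝓕 f =ᵐ[volume] (𝓕 (h2.toLp f) : Lp ℂ 2 (volume : Measure V)) := by
  have hcont : Continuous (𝓕 f) :=
    VectorFourier.fourierIntegral_continuous Real.continuous_fourierChar
      (by exact continuous_inner) h1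
  -- Both sides are tested against smooth compactly supported `g`; in each pairing the Fourier
  -- transform moves onto `g`, viewed as a Schwartz function.
  refine ae_eq_of_integral_contDiff_smul_eq hcont.locallyIntegrable
    ((Lp.memLp _).locallyIntegrable one_le_two) fun g hg hgc => ?_
  have hg₁ : HasCompactSupport (Complex.ofRealCLM ∘ g) := hgc.comp_left rfl
  have hg₂ : ContDiff ℝ ∞ (Complex.ofRealCLM ∘ g) := by fun_prop
  set G : SchwartzMap V ℂ := hg₁.toSchwartzMap hg₂ with hG
  have hGg : ∀ x, G x = (g x : ℂ) := fun x => rfl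
  have e1 : ∫ x, g x • 𝓕 f x = ∫ x, 𝓕 (G : V → ℂ) x • f x := by
    have := VectorFourier.integral_fourierIntegral_smul_eq_flip (L := innerₗ V)
      Real.continuous_fourierChar continuous_inner (G.integrable (μ := volume)) h1
    simp only [flip_innerₗ] at this
    exact this.symm
  have e2 : ∫ x, 𝓕 (G : V → ℂ) x • f x = ∫ x, (𝓕 G) x • (h2.toLp f) x := by
    refine integral_congr_ae ?_
    filter_upwards [h2.coeFn_toLp] with x hx
    rw [hx, SchwartzMap.fourier_coe]
  have e3 := congrArg (fun u => u G) (Lp.fourier_toTemperedDistribution_eq (h2.toLp f))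
  simp only [TemperedDistribution.fourier_apply, Lp.toTemperedDistribution_apply] at e3
  rw [e1, e2, e3]
  rfl

theorem memLp_fourier {f : V → ℂ} (h1 : Integrable f) (h2 : MemLp f 2) : MemLp (𝓕 f) 2 :=
  (Lp.memLp _).ae_eq (fourier_ae_eq_fourier_toLp h1 h2).symm

theorem integral_inner_fourier {f g : V → ℂ} (f1 : Integrable f) (f2 : MemLp f 2)
    (g1 : Integrable g) (g2 : MemLp g 2) :
    ∫ w, inner ℂ (𝓕 f w) (𝓕 g w) = ∫ t, inner ℂ (f t) (g t) := by
  have h := Lp.inner_fourier_eq (f2.toLp f) (g2.toLp g)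
  rw [L2.inner_def, L2.inner_def] at h
  refine (integral_congr_ae ?_).trans (h.trans (integral_congr_ae ?_))
  · filter_upwards [fourier_ae_eq_fourier_toLp f1 f2, fourier_ae_eq_fourier_toLp g1 g2]
      with x hx hy
    rw [hx, hy]
  · filter_upwards [f2.coeFn_toLp, g2.coeFn_toLp] with x hx hy
    rw [hx, hy]

end Plancherel

/-! ### Traces through singular value expansions -/

section Trace

variable {H : Type*} [NormedAddCommGroup H] [InnerProductSpace ℂ H]

/-- Pairing with an expansion `T ζ = ∑ᵢ sᵢ ⟨φᵢ, ζ⟩ ψᵢ`. -/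
theorem hasSum_inner_apply {ι : Type*} {T : H →L[ℂ] H} {s : ι → ℝ} {ψ φ : ι → H}
    (hT : ∀ ζ : H, HasSum (fun i => ((s i : ℂ) * inner ℂ (φ i) ζ) • ψ i) (T ζ)) (ξ ζ : H) :
    HasSum (fun i => (s i : ℂ) * (inner ℂ (φ i) ζ * inner ℂ ξ (ψ i))) (inner ℂ ξ (T ζ)) := by
  have h := (hT ζ).mapL (innerSL ℂ ξ)
  simpa only [innerSL_apply_apply, inner_smul_right, mul_assoc] using h

variable [CompleteSpace H]

/-- The trace of an operator with weak expansion `∑ᵢ sᵢ ⟨φᵢ, ·⟩ ψᵢ`. -/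
theorem tr_eq_tsum {ι : Type*} (A : H →L[ℂ] H) (s : ι → ℝ) (ψ φ : ι → H)
    (hs : ∀ i, 0 ≤ s i) (hsum : Summable s) {C D : ℝ} (hψ : ∀ i, ‖ψ i‖ ≤ C) (hφ : ∀ i, ‖φ i‖ ≤ D)
    (hA : ∀ ζ : H, inner ℂ ζ (A ζ) = ∑' i, (s i : ℂ) * (inner ℂ (φ i) ζ * inner ℂ ζ (ψ i))) :
    tr A = ∑' i, (s i : ℂ) * inner ℂ (φ i) (ψ i) := by
  have hsq : ∀ x : H, HasSum (fun n => ‖inner ℂ (onb H n) x‖ ^ 2) (‖x‖ ^ 2) := by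
    intro x
    have h := (onb H).hasSum_inner_mul_inner x x
    rw [inner_self_eq_norm_sq_to_K] at h
    have h' := Complex.hasSum_re h
    convert h' using 1
    · ext n
      rw [← inner_conj_symm x, mul_comm, Complex.mul_conj, Complex.normSq_eq_norm_sq,
        Complex.ofReal_re]
    · norm_cast
  have key : ∀ x y : H, Summable (fun n => ‖inner ℂ x (onb H n) * inner ℂ (onb H n) y‖) ∧
      ∑' n, ‖inner ℂ x (onb H n) * inner ℂ (onb H n) y‖ ≤ ‖x‖ ^ 2 + ‖y‖ ^ 2 := by
    intro x y
    have hle : ∀ n, ‖inner ℂ x (onb H n) * inner ℂ (onb H n) y‖ ≤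
        ‖inner ℂ (onb H n) x‖ ^ 2 + ‖inner ℂ (onb H n) y‖ ^ 2 := by
      intro n
      rw [norm_mul, norm_inner_symm x]
      nlinarith [sq_nonneg (‖inner ℂ (onb H n) x‖ - ‖inner ℂ (onb H n) y‖),
        sq_nonneg ‖inner ℂ (onb H n) x‖, sq_nonneg ‖inner ℂ (onb H n) y‖]
    have hS := (hsq x).add (hsq y)
    have hsm := Summable.of_nonneg_of_le (fun n => norm_nonneg _) hle hS.summable
    exact ⟨hsm, (hsm.tsum_le_tsum hle hS.summable).trans_eq hS.tsum_eq⟩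
  -- Absolute summability over basis and expansion indices together justifies exchanging the sums;
  -- Parseval then collapses the sum over the basis.
  have hdouble : Summable (Function.uncurry fun i n =>
      (s i : ℂ) * (inner ℂ (φ i) (onb H n) * inner ℂ (onb H n) (ψ i))) := by
    refine Summable.of_norm ?_
    refine (summable_prod_of_nonneg fun _ => norm_nonneg _).2 ⟨fun i => ?_, ?_⟩
    · simpa only [Function.uncurry_apply_pair, norm_mul (s i : ℂ)] using
        (key (φ i) (ψ i)).1.mul_left ‖(s i : ℂ)‖
    · refine Summable.of_nonneg_of_le (fun i => tsum_nonneg fun _ => norm_nonneg _)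
        (fun i => ?_) (hsum.mul_right (D ^ 2 + C ^ 2))
      simp only [Function.uncurry_apply_pair, norm_mul (s i : ℂ)]
      rw [tsum_mul_left, Complex.norm_real, Real.norm_of_nonneg (hs i)]
      refine mul_le_mul_of_nonneg_left ((key (φ i) (ψ i)).2.trans ?_) (hs i)
      gcongr
      exacts [hφ i, hψ i]
  calc tr A = ∑' n, ∑' i, (s i : ℂ) * (inner ℂ (φ i) (onb H n) * inner ℂ (onb H n) (ψ i)) :=
        tsum_congr fun n => hA _
    _ = ∑' i, ∑' n, (s i : ℂ) * (inner ℂ (φ i) (onb H n) * inner ℂ (onb H n) (ψ i)) :=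
        hdouble.tsum_comm
    _ = _ := tsum_congr fun i => by rw [tsum_mul_left, (onb H).tsum_inner_mul_inner]

theorem tr_comp {ι : Type*} {T : H →L[ℂ] H} {s : ι → ℝ} {ψ φ : ι → H}
    (hs : ∀ i, 0 < s i) (hsum : Summable s) (hψ : Orthonormal ℂ ψ) (hφ : Orthonormal ℂ φ)
    (hT : ∀ ζ : H, HasSum (fun i => ((s i : ℂ) * inner ℂ (φ i) ζ) • ψ i) (T ζ)) (B : H →L[ℂ] H) :
    tr (B ∘L T) = ∑' i, (s i : ℂ) * inner ℂ (φ i) (B (ψ i)) := by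
  refine tr_eq_tsum _ s (fun i => B (ψ i)) φ (fun i => (hs i).le) hsum (C := ‖B‖) (D := 1)
    (fun i => (B.le_opNorm _).trans_eq (by rw [hψ.1, mul_one])) (fun i => (hφ.1 i).le)
    fun ζ => ?_
  have h := (hasSum_inner_apply hT (ContinuousLinearMap.adjoint B ζ) ζ).tsum_eq
  simpa only [ContinuousLinearMap.adjoint_inner_left, ContinuousLinearMap.comp_apply] using h.symm

/-- Taking adjoints swaps the two systems, and `B` passes to `ψ` as its adjoint: `T* B = ∑ᵢ sᵢ ⟨B*
ψᵢ, ·⟩ φᵢ`, weakly. Cyclicity of the trace is not needed. -/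
theorem tr_adjoint_comp {ι : Type*} {T : H →L[ℂ] H} {s : ι → ℝ} {ψ φ : ι → H}
    (hs : ∀ i, 0 < s i) (hsum : Summable s) (hψ : Orthonormal ℂ ψ) (hφ : Orthonormal ℂ φ)
    (hT : ∀ ζ : H, HasSum (fun i => ((s i : ℂ) * inner ℂ (φ i) ζ) • ψ i) (T ζ)) (B : H →L[ℂ] H) :
    tr (ContinuousLinearMap.adjoint T ∘L B) = ∑' i, (s i : ℂ) * inner ℂ (ψ i) (B (φ i)) := by
  have h := tr_eq_tsum (ContinuousLinearMap.adjoint T ∘L B) s φ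
    (fun i => ContinuousLinearMap.adjoint B (ψ i)) (fun i => (hs i).le) hsum (C := 1)
    (D := ‖ContinuousLinearMap.adjoint B‖) (fun i => (hφ.1 i).le)
    (fun i => (ContinuousLinearMap.le_opNorm _ _).trans_eq (by rw [hψ.1, mul_one])) fun ζ => ?_
  · simpa only [ContinuousLinearMap.adjoint_inner_left] using h
  · have h := (hasSum_inner_apply hT (B ζ) ζ).tsum_eq
    rw [ContinuousLinearMap.comp_apply, ContinuousLinearMap.adjoint_inner_right,
      ← inner_conj_symm, ← h, Complex.conj_tsum]
    refine tsum_congr fun i => ?_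
    simp only [map_mul, Complex.conj_ofReal, inner_conj_symm,
      ContinuousLinearMap.adjoint_inner_left]
    ring

end Trace

/-! ### Matrix coefficients and Moyal's identity -/

section Moyal

variable {d : ℕ}

/-- The correlation integrand of `f` and `g` is integrable on the product. -/
theorem integrable_mul_shift {f g : EuclideanSpace ℝ (Fin d) → ℂ} (hf : Integrable f)
    (hg : Integrable g) :
    Integrable (fun p : Phase d => f p.2 * g (p.2 - p.1)) := by
  have h := Integrable.convolution_integrand (ContinuousLinearMap.mul ℂ ℂ) hf hg.comp_neg
  simp only [ContinuousLinearMap.mul_apply', neg_sub] at h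
  exact h

/-- The inner integral is the convolution of `f` with the reflection of `g`. -/
theorem integral_integral_mul_shift {f g : EuclideanSpace ℝ (Fin d) → ℂ} (hf : Integrable f)
    (hg : Integrable g) :
    ∫ x, ∫ t, f t * g (t - x) = (∫ t, f t) * ∫ t, g t := by
  have h := integral_convolution (ContinuousLinearMap.mul ℂ ℂ) hf hg.comp_neg
  simpa only [convolution, ContinuousLinearMap.mul_apply', neg_sub, integral_neg_eq_self]
    using h

/-- The function whose Fourier transform at `ω` is `⟨π(x, ω) b, a⟩`. -/
def ambiguityKernel (b a : L2 d) (x t : EuclideanSpace ℝ (Fin d)) : ℂ :=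
  a t * starRingEnd ℂ (b (t - x))

theorem coeFn_tfShift (z : Phase d) (b : L2 d) : tfShift z b =ᵐ[volume] shiftFun z b :=
  (memLp_shiftFun z b).coeFn_toLp

theorem memLp_two_shift (b : L2 d) (x : EuclideanSpace ℝ (Fin d)) :
    MemLp (fun t => b (t - x)) 2 :=
  (Lp.memLp b).comp_measurePreserving (measurePreserving_sub_right volume x)

theorem integrable_conj_mul (a c : L2 d) :
    Integrable (fun t => starRingEnd ℂ (a t) * c t) := by
  exact (Lp.memLp a).star.integrable_mul (Lp.memLp c)

theorem integrable_ambiguityKernel (b a : L2 d) (x : EuclideanSpace ℝ (Fin d)) :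
    Integrable (ambiguityKernel b a x) := by
  exact (Lp.memLp a).integrable_mul (memLp_two_shift b x).star

theorem stronglyMeasurable_ambiguityKernel (b a : L2 d) :
    StronglyMeasurable (fun p : Phase d => ambiguityKernel b a p.1 p.2) := by
  have h1 : StronglyMeasurable fun p : Phase d => a p.2 :=
    (Lp.stronglyMeasurable a).comp_measurable measurable_snd
  have h2 : StronglyMeasurable fun p : Phase d => b (p.2 - p.1) :=
    (Lp.stronglyMeasurable b).comp_measurable (measurable_snd.sub measurable_fst)
  exact h1.mul h2.star

theorem inner_tfShift (z : Phase d) (b a : L2 d) :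
    inner ℂ (tfShift z b) a = 𝓕 (ambiguityKernel b a z.1) z.2 := by
  rw [L2.inner_def, Real.fourier_eq']
  refine integral_congr_ae ?_
  filter_upwards [coeFn_tfShift z b] with t ht
  rw [ht, RCLike.inner_apply, shiftFun, ambiguityKernel, map_mul, ← Complex.exp_conj, smul_eq_mul,
    real_inner_comm]
  simp only [map_mul, Complex.conj_ofReal, Complex.conj_I, map_ofNat]
  rw [show 2 * (Real.pi : ℂ) * -Complex.I * ((inner ℝ t z.2 : ℝ) : ℂ)
      = ((-2 * Real.pi * inner ℝ t z.2 : ℝ) : ℂ) * Complex.I by push_cast; ring]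
  ring

theorem stronglyMeasurable_inner_tfShift (b a : L2 d) :
    StronglyMeasurable fun z : Phase d => inner ℂ (tfShift z b) a := by
  simp only [inner_tfShift, Real.fourier_eq']
  refine StronglyMeasurable.integral_prod_right (f := fun (z : Phase d) v =>
    Complex.exp (((-2 * Real.pi * inner ℝ v z.2 : ℝ) : ℂ) * Complex.I) •
      ambiguityKernel b a z.1 v) ?_
  refine StronglyMeasurable.mul (f := fun q : Phase d × EuclideanSpace ℝ (Fin d) =>
    Complex.exp (((-2 * Real.pi * inner ℝ q.2 q.1.2 : ℝ) : ℂ) * Complex.I))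
    (g := fun q => ambiguityKernel b a q.1.1 q.2) ?_ ?_
  · refine Continuous.stronglyMeasurable ?_
    fun_prop
  · exact (stronglyMeasurable_ambiguityKernel b a).comp_measurable
      (measurable_fst.fst.prodMk measurable_snd)

/-- This regrouping separates a function of `t` from a function of `t - x`, and so produces the two
factors in Moyal's identity. -/
theorem conj_ambiguityKernel_mul (b a e c : L2 d) (x t : EuclideanSpace ℝ (Fin d)) :
    starRingEnd ℂ (ambiguityKernel b a x t) * ambiguityKernel e c x t =
      (starRingEnd ℂ (a t) * c t) * (starRingEnd ℂ (e (t - x)) * b (t - x)) := by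
  simp only [ambiguityKernel, map_mul, Complex.conj_conj]
  ring

theorem integrable_conj_ambiguityKernel_mul (b a e c : L2 d) :
    Integrable fun p : Phase d =>
      starRingEnd ℂ (ambiguityKernel b a p.1 p.2) * ambiguityKernel e c p.1 p.2 := by
  simp only [conj_ambiguityKernel_mul]
  exact integrable_mul_shift (integrable_conj_mul a c) (integrable_conj_mul e b)

/-- For almost every `x` the ambiguity kernel is square integrable. -/
theorem ae_memLp_ambiguityKernel (b a : L2 d) :
    ∀ᵐ x : EuclideanSpace ℝ (Fin d), MemLp (ambiguityKernel b a x) 2 := by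
  -- A product of two `L²` functions need only be `L¹` for a given `x`; Fubini gives square
  -- integrability for almost every `x`.
  have h := (integrable_conj_ambiguityKernel_mul b a b a).prod_right_ae
  filter_upwards [h] with x hx
  rw [memLp_two_iff_integrable_sq_norm (integrable_ambiguityKernel b a x).1]
  refine hx.norm.congr (Filter.Eventually.of_forall fun t => ?_)
  simp [sq]

theorem ae_integral_conj_inner_mul (b a e c : L2 d) :
    ∀ᵐ x : EuclideanSpace ℝ (Fin d),
      (∫ w, starRingEnd ℂ (inner ℂ (tfShift (x, w) b) a) * inner ℂ (tfShift (x, w) e) c) =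
        ∫ t, (starRingEnd ℂ (a t) * c t) * (starRingEnd ℂ (e (t - x)) * b (t - x)) := by
  filter_upwards [ae_memLp_ambiguityKernel b a, ae_memLp_ambiguityKernel e c] with x h1 h2
  simp only [inner_tfShift, ← conj_ambiguityKernel_mul]
  have h := integral_inner_fourier (integrable_ambiguityKernel b a x) h1
    (integrable_ambiguityKernel e c x) h2
  simpa only [RCLike.inner_apply, mul_comm] using h

/-- Plancherel in `ω` turns the squared norm on each slice into the correlation of `|a|²` and `|b|²`
at `x`, which is integrable in `x`. Knowing this first makes Fubini available for Moyal's identity.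
-/
theorem memLp_inner_tfShift (b a : L2 d) :
    MemLp (fun z : Phase d => inner ℂ (tfShift z b) a) 2 := by
  have hm := stronglyMeasurable_inner_tfShift b a
  rw [memLp_two_iff_integrable_sq_norm hm.aestronglyMeasurable, Measure.volume_eq_prod,
    integrable_prod_iff (by exact (hm.norm.pow 2).aestronglyMeasurable)]
  constructor
  · filter_upwards [ae_memLp_ambiguityKernel b a] with x hx
    have h := memLp_fourier (integrable_ambiguityKernel b a x) hx
    simp only [inner_tfShift]
    exact (memLp_two_iff_integrable_sq_norm h.1).1 h
  · have h := (integrable_mul_shift (integrable_conj_mul a a)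
      (integrable_conj_mul b b)).integral_prod_left.norm
    refine h.congr ?_
    filter_upwards [ae_integral_conj_inner_mul b a b a] with x hx
    rw [← hx]
    have e : ∀ w, starRingEnd ℂ (inner ℂ (tfShift (x, w) b) a) * inner ℂ (tfShift (x, w) b) a
        = ((‖inner ℂ (tfShift (x, w) b) a‖ ^ 2 : ℝ) : ℂ) := by
      intro w
      rw [mul_comm, Complex.mul_conj, Complex.normSq_eq_norm_sq]
    simp only [e, integral_complex_ofReal, Complex.norm_real, norm_norm, norm_pow]
    rw [Real.norm_of_nonneg (integral_nonneg fun w => by positivity)]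

theorem integrable_moyal (b a e c : L2 d) :
    Integrable fun z : Phase d =>
      starRingEnd ℂ (inner ℂ (tfShift z b) a) * inner ℂ (tfShift z e) c := by
  exact (memLp_inner_tfShift b a).star.integrable_mul (memLp_inner_tfShift e c)

/-- Moyal's identity. -/
theorem integral_moyal (b a e c : L2 d) :
    ∫ z : Phase d, starRingEnd ℂ (inner ℂ (tfShift z b) a) * inner ℂ (tfShift z e) c =
      inner ℂ a c * inner ℂ e b := by
  have hi := integrable_moyal b a e c
  rw [Measure.volume_eq_prod] at hi ⊢
  rw [integral_prod _ hi, integral_congr_ae (ae_integral_conj_inner_mul b a e c),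
    integral_integral_mul_shift (integrable_conj_mul a c) (integrable_conj_mul e b),
    L2.inner_def, L2.inner_def]
  simp only [RCLike.inner_apply, mul_comm]

theorem integral_norm_sq_inner_tfShift (b a : L2 d) :
    ∫ z : Phase d, ‖inner ℂ (tfShift z b) a‖ ^ 2 = ‖a‖ ^ 2 * ‖b‖ ^ 2 := by
  have h := integral_moyal b a b a
  have e : ∀ z, starRingEnd ℂ (inner ℂ (tfShift z b) a) * inner ℂ (tfShift z b) a
      = ((‖inner ℂ (tfShift z b) a‖ ^ 2 : ℝ) : ℂ) := by
    intro z
    rw [mul_comm, Complex.mul_conj, Complex.normSq_eq_norm_sq]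
  simp only [e, integral_complex_ofReal, inner_self_eq_norm_sq_to_K] at h
  apply Complex.ofReal_injective
  rw [h]
  push_cast
  rfl

/-- By `|uv| ≤ (|u|² + |v|²) / 2`, where both squares integrate to `1`. The uniform bound lets
products of singular values dominate the series. -/
theorem integral_norm_moyal_le (b a e c : L2 d) (ha : ‖a‖ = 1) (hb : ‖b‖ = 1) (hc : ‖c‖ = 1)
    (he : ‖e‖ = 1) :
    ∫ z : Phase d, ‖starRingEnd ℂ (inner ℂ (tfShift z b) a) * inner ℂ (tfShift z e) c‖ ≤ 1 := by
  have h1 := (memLp_inner_tfShift b a).integrable_norm_pow two_ne_zero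
  have h2 := (memLp_inner_tfShift e c).integrable_norm_pow two_ne_zero
  have h := integral_mono (integrable_moyal b a e c).norm ((h1.add h2).div_const 2) fun z => ?_
  · refine h.trans_eq ?_
    rw [integral_div]
    simp only [Pi.add_apply]
    rw [integral_add h1 h2, integral_norm_sq_inner_tfShift, integral_norm_sq_inner_tfShift,
      ha, hb, hc, he]
    norm_num
  · simp only [norm_mul, RCLike.norm_conj, Pi.add_apply]
    nlinarith [sq_nonneg (‖inner ℂ (tfShift z b) a‖ - ‖inner ℂ (tfShift z e) c‖)]

end Moyal

/-! ### Commutation relation and the symplectic character -/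

section Commutation

variable {d : ℕ}

theorem tfShift_tfShift_ae (z w : Phase d) (ψ : L2 d) :
    tfShift z (tfShift w ψ) =ᵐ[volume] shiftFun z (shiftFun w ψ) := by
  have h := (measurePreserving_sub_right (volume : Measure (EuclideanSpace ℝ (Fin d)))
    z.1).quasiMeasurePreserving.ae (coeFn_tfShift w ψ)
  filter_upwards [coeFn_tfShift z (tfShift w ψ), h] with t h1 h2
  rw [h1, shiftFun, h2]
  rfl

/-- The canonical commutation relation of time-frequency shifts. -/
theorem tfShift_comm (z w : Phase d) (ψ : L2 d) :
    tfShift z (tfShift w ψ) =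
      Complex.exp (2 * Real.pi * Complex.I * ((symp z w : ℝ) : ℂ)) • tfShift w (tfShift z ψ) := by
  refine Lp.ext ?_
  filter_upwards [tfShift_tfShift_ae z w ψ, tfShift_tfShift_ae w z ψ,
    Lp.coeFn_smul (Complex.exp (2 * Real.pi * Complex.I * ((symp z w : ℝ) : ℂ)))
      (tfShift w (tfShift z ψ))] with t h1 h2 h3
  rw [h3, Pi.smul_apply, h1, h2, smul_eq_mul]
  simp only [shiftFun, symp, inner_sub_right, ← mul_assoc, ← Complex.exp_add]
  rw [sub_right_comm t z.1 w.1]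
  congr 2
  push_cast
  ring

theorem inner_tfShift_tfShift (z : Phase d) (ψ χ : L2 d) :
    inner ℂ (tfShift z ψ) (tfShift z χ) = inner ℂ ψ χ :=
  (tfShiftIsometry z).inner_map_map ψ χ

theorem norm_tfShift (z : Phase d) (ψ : L2 d) : ‖tfShift z ψ‖ = ‖ψ‖ :=
  (tfShiftIsometry z).norm_map ψ

/-- Apply the isometry `π(z)` to both entries and commute it past `π(w)`: the phase is exactly the
character. A Fourier integral of matrix coefficients thus becomes another Moyal integral. -/
theorem conj_inner_mul_exp (z w : Phase d) (ψ χ : L2 d) :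
    starRingEnd ℂ (inner ℂ (tfShift w ψ) χ) *
        Complex.exp (-(2 * Real.pi * Complex.I * ((symp z w : ℝ) : ℂ))) =
      starRingEnd ℂ (inner ℂ (tfShift w (tfShift z ψ)) (tfShift z χ)) := by
  rw [inner_conj_symm, inner_conj_symm, ← inner_tfShift_tfShift z χ, tfShift_comm z w,
    inner_smul_right, mul_right_comm, ← Complex.exp_add, add_neg_cancel, Complex.exp_zero,
    one_mul]

/-- The symplectic Fourier transform of a product of two matrix coefficients. -/
theorem symplecticFourier_moyal (z : Phase d) (b a e c : L2 d) :
    symplecticFourier (fun w => starRingEnd ℂ (inner ℂ (tfShift w b) a) *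
      inner ℂ (tfShift w e) c) z = inner ℂ (tfShift z a) c * inner ℂ e (tfShift z b) := by
  rw [← integral_moyal, symplecticFourier]
  refine integral_congr_ae (Filter.Eventually.of_forall fun w => ?_)
  simp only [mul_right_comm _ (inner ℂ (tfShift w e) c), conj_inner_mul_exp]

end Commutation

/-! ### Summation over pairs of singular values -/

section Series

theorem integrable_tsum_of_summable_integral_norm {α E ι : Type*} [MeasurableSpace α]
    {μ : Measure α} [NormedAddCommGroup E] [CompleteSpace E] [Countable ι]
    {F : ι → α → E} (hF : ∀ i, Integrable (F i) μ) (hsum : Summable fun i => ∫ a, ‖F i a‖ ∂μ)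
    (hpt : ∀ a, Summable fun i => F i a) : Integrable (fun a => ∑' i, F i a) μ := by
  refine ⟨aestronglyMeasurable_of_tendsto_ae Filter.atTop
    (f := fun (u : Finset ι) a => ∑ i ∈ u, F i a)
    (fun u => (integrable_finsetSum u fun i _ => hF i).1)
    (Filter.Eventually.of_forall fun a => (hpt a).hasSum), ?_⟩
  calc ∫⁻ a, ‖∑' i, F i a‖ₑ ∂μ ≤ ∫⁻ a, ∑' i, ‖F i a‖ₑ ∂μ :=
        lintegral_mono fun a => enorm_tsum_le_tsum_enorm
    _ = ∑' i, ∫⁻ a, ‖F i a‖ₑ ∂μ := lintegral_tsum fun i => (hF i).1.enorm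
    _ = ∑' i, ENNReal.ofReal (∫ a, ‖F i a‖ ∂μ) :=
        tsum_congr fun i => (ofReal_integral_norm_eq_lintegral_enorm (hF i)).symm
    _ < ⊤ := hsum.tsum_ofReal_lt_top

/-- Countability of the expansion indices is what exchanging sum and integral requires. -/
theorem countable_of_summable_pos {ι : Type*} {s : ι → ℝ} (hs : ∀ i, 0 < s i)
    (hsum : Summable s) : Countable ι := by
  have h := hsum.countable_support
  rw [Set.eq_univ_of_forall (s := Function.support s) fun i => (hs i).ne'] at h
  exact Set.countable_univ_iff.1 h

variable {d : ℕ} {ι κ : Type*} {S T : L2 d →L[ℂ] L2 d} {s : ι → ℝ} {ψ φ : ι → L2 d}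
  {t : κ → ℝ} {χ η : κ → L2 d}

/-- The term of `tr (T* α_z(S))` that belongs to the `j`-th singular value of `T` and the `i`-th
singular value of `S`. -/
def coeffTerm (s : ι → ℝ) (ψ φ : ι → L2 d) (t : κ → ℝ) (χ η : κ → L2 d) (p : κ × ι)
    (z : Phase d) : ℂ :=
  (t p.1 * s p.2 : ℝ) * (starRingEnd ℂ (inner ℂ (tfShift z (ψ p.2)) (χ p.1)) *
    inner ℂ (tfShift z (φ p.2)) (η p.1))

theorem integrable_coeffTerm (p : κ × ι) : Integrable (coeffTerm s ψ φ t χ η p) :=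
  (integrable_moyal _ _ _ _).const_mul _

theorem summable_mul_prod (hs : ∀ i, 0 < s i) (hsum : Summable s) (ht : ∀ j, 0 < t j)
    (htsum : Summable t) : Summable fun p : κ × ι => t p.1 * s p.2 :=
  htsum.mul_of_nonneg hsum (fun j => (ht j).le) fun i => (hs i).le

theorem summable_coeffTerm (hs : ∀ i, 0 < s i) (hsum : Summable s) (hψ : Orthonormal ℂ ψ)
    (hφ : Orthonormal ℂ φ) (ht : ∀ j, 0 < t j) (htsum : Summable t) (hχ : Orthonormal ℂ χ)
    (hη : Orthonormal ℂ η) (z : Phase d) : Summable fun p => coeffTerm s ψ φ t χ η p z := by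
  refine Summable.of_norm_bounded (summable_mul_prod hs hsum ht htsum) fun p => ?_
  have h0 := mul_nonneg (ht p.1).le (hs p.2).le
  have h1 := norm_inner_le_norm (𝕜 := ℂ) (tfShift z (ψ p.2)) (χ p.1)
  have h2 := norm_inner_le_norm (𝕜 := ℂ) (tfShift z (φ p.2)) (η p.1)
  rw [norm_tfShift, hψ.1, hχ.1, mul_one] at h1
  rw [norm_tfShift, hφ.1, hη.1, mul_one] at h2
  rw [coeffTerm, norm_mul, norm_mul, Complex.norm_real, Real.norm_of_nonneg h0, RCLike.norm_conj]
  exact mul_le_of_le_one_right h0 (mul_le_one₀ h1 (norm_nonneg _) h2)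

theorem summable_integral_norm_coeffTerm (hs : ∀ i, 0 < s i) (hsum : Summable s)
    (hψ : Orthonormal ℂ ψ) (hφ : Orthonormal ℂ φ) (ht : ∀ j, 0 < t j) (htsum : Summable t)
    (hχ : Orthonormal ℂ χ) (hη : Orthonormal ℂ η) :
    Summable fun p => ∫ z, ‖coeffTerm s ψ φ t χ η p z‖ := by
  refine Summable.of_nonneg_of_le (fun p => integral_nonneg fun z => norm_nonneg _) (fun p => ?_)
    (summable_mul_prod hs hsum ht htsum)
  have h0 := mul_nonneg (ht p.1).le (hs p.2).le
  simp only [coeffTerm, norm_mul ((t p.1 * s p.2 : ℝ) : ℂ), Complex.norm_real,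
    Real.norm_of_nonneg h0]
  rw [integral_const_mul]
  exact mul_le_of_le_one_right h0
    (integral_norm_moyal_le _ _ _ _ (hχ.1 _) (hψ.1 _) (hη.1 _) (hφ.1 _))

theorem tr_adjoint_comp_opShift (hs : ∀ i, 0 < s i) (hsum : Summable s) (hψ : Orthonormal ℂ ψ)
    (hφ : Orthonormal ℂ φ)
    (hS : ∀ ζ, HasSum (fun i => ((s i : ℂ) * inner ℂ (φ i) ζ) • ψ i) (S ζ))
    (ht : ∀ j, 0 < t j) (htsum : Summable t) (hχ : Orthonormal ℂ χ) (hη : Orthonormal ℂ η)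
    (hT : ∀ ζ, HasSum (fun j => ((t j : ℂ) * inner ℂ (η j) ζ) • χ j) (T ζ)) (z : Phase d) :
    tr (ContinuousLinearMap.adjoint T ∘L opShift z S) = ∑' p, coeffTerm s ψ φ t χ η p z := by
  rw [(summable_coeffTerm hs hsum hψ hφ ht htsum hχ hη z).tsum_prod,
    tr_adjoint_comp ht htsum hχ hη hT]
  refine tsum_congr fun j => ?_
  rw [opShift, ContinuousLinearMap.comp_apply, ContinuousLinearMap.comp_apply,
    ← ContinuousLinearMap.adjoint_inner_left, ← (hasSum_inner_apply hS _ _).tsum_eq,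
    ← tsum_mul_left]
  refine tsum_congr fun i => ?_
  rw [ContinuousLinearMap.adjoint_inner_left, ContinuousLinearMap.adjoint_inner_right, coeffTerm,
    inner_conj_symm]
  push_cast
  ring

theorem symplecticFourier_tr_adjoint_comp_opShift (hs : ∀ i, 0 < s i) (hsum : Summable s)
    (hψ : Orthonormal ℂ ψ) (hφ : Orthonormal ℂ φ)
    (hS : ∀ ζ, HasSum (fun i => ((s i : ℂ) * inner ℂ (φ i) ζ) • ψ i) (S ζ))
    (ht : ∀ j, 0 < t j) (htsum : Summable t) (hχ : Orthonormal ℂ χ) (hη : Orthonormal ℂ η)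
    (hT : ∀ ζ, HasSum (fun j => ((t j : ℂ) * inner ℂ (η j) ζ) • χ j) (T ζ)) (z : Phase d) :
    symplecticFourier (fun w => tr (ContinuousLinearMap.adjoint T ∘L opShift w S)) z =
      starRingEnd ℂ (tr (tfShift z ∘L T)) * tr (tfShift z ∘L S) := by
  have := countable_of_summable_pos hs hsum
  have := countable_of_summable_pos ht htsum
  have hexp : ∀ w, ‖Complex.exp (-(2 * Real.pi * Complex.I * ((symp z w : ℝ) : ℂ)))‖ = 1 := by
    intro w
    rw [show -(2 * Real.pi * Complex.I * ((symp z w : ℝ) : ℂ))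
      = ((-(2 * Real.pi * symp z w) : ℝ) : ℂ) * Complex.I by push_cast; ring,
      Complex.norm_exp_ofReal_mul_I]
  have hcont : Continuous fun w : Phase d =>
      Complex.exp (-(2 * Real.pi * Complex.I * ((symp z w : ℝ) : ℂ))) := by
    unfold symp
    fun_prop
  -- Each transformed term splits into a factor depending on `T` alone and one depending on `S`
  -- alone, so the double series is a product of two traces.
  have hterm : ∀ p : κ × ι, symplecticFourier (coeffTerm s ψ φ t χ η p) z =
      (t p.1 * inner ℂ (tfShift z (χ p.1)) (η p.1)) *
        (s p.2 * inner ℂ (φ p.2) (tfShift z (ψ p.2))) := by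
    intro p
    have h := symplecticFourier_moyal z (ψ p.2) (χ p.1) (φ p.2) (η p.1)
    simp only [symplecticFourier, coeffTerm, mul_assoc _ (_ * _) (Complex.exp _)] at h ⊢
    rw [integral_const_mul, h]
    push_cast
    ring
  have hle : ∀ (ν : ℝ) (a b : L2 d), 0 ≤ ν → ‖a‖ = 1 → ‖b‖ = 1 →
      ‖(ν : ℂ) * inner ℂ a b‖ ≤ ν := by
    intro ν a b hν ha hb
    have h := norm_inner_le_norm (𝕜 := ℂ) a b
    rw [ha, hb, mul_one] at h
    rw [norm_mul, Complex.norm_real, Real.norm_of_nonneg hν]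
    exact mul_le_of_le_one_right hν h
  rw [tr_comp hs hsum hψ hφ hS, tr_comp ht htsum hχ hη hT, Complex.conj_tsum]
  simp only [map_mul, Complex.conj_ofReal, inner_conj_symm]
  rw [tsum_mul_tsum_of_summable_norm
    (Summable.of_nonneg_of_le (fun _ => norm_nonneg _)
      (fun j => hle _ _ _ (ht j).le (by rw [norm_tfShift, hχ.1]) (hη.1 j)) htsum)
    (Summable.of_nonneg_of_le (fun _ => norm_nonneg _)
      (fun i => hle _ _ _ (hs i).le (hφ.1 i) (by rw [norm_tfShift, hψ.1])) hsum)]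
  simp only [← hterm]
  simp only [symplecticFourier, tr_adjoint_comp_opShift hs hsum hψ hφ hS ht htsum hχ hη hT,
    ← tsum_mul_right]
  refine (integral_tsum_of_summable_integral_norm (fun p => ?_) ?_).symm
  · exact (integrable_coeffTerm p).mul_bdd (c := 1) hcont.aestronglyMeasurable
      (Filter.Eventually.of_forall fun w => (hexp w).le)
  · simp only [norm_mul, hexp, mul_one]
    exact summable_integral_norm_coeffTerm hs hsum hψ hφ ht htsum hχ hη

end Series

/-! ### Integrability, the product formula and a nonvanishing witness -/

section Main

variable {d : ℕ}

theorem integrable_traceFunctional {S : L2 d →L[ℂ] L2 d} (hS : IsTraceClass S)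
    {ρ : (L2 d →L[ℂ] L2 d) → ℂ} (hρ : ρ ∈ traceFunctionals (L2 d)) :
    Integrable fun z : Phase d => ρ (opShift z S) := by
  obtain ⟨T, ⟨κ, t, χ, η, ht, htsum, hχ, hη, hT⟩, rfl⟩ := hρ
  obtain ⟨ι, s, ψ, φ, hs, hsum, hψ, hφ, hS⟩ := hS
  have := countable_of_summable_pos hs hsum
  have := countable_of_summable_pos ht htsum
  simp only [tr_adjoint_comp_opShift hs hsum hψ hφ hS ht htsum hχ hη hT]
  exact integrable_tsum_of_summable_integral_norm integrable_coeffTerm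
    (summable_integral_norm_coeffTerm hs hsum hψ hφ ht htsum hχ hη)
    (summable_coeffTerm hs hsum hψ hφ ht htsum hχ hη)

theorem symplecticFourier_traceFunctional {S T : L2 d →L[ℂ] L2 d} (hS : IsTraceClass S)
    (hT : IsTraceClass T) (z : Phase d) :
    symplecticFourier (fun w => tr (ContinuousLinearMap.adjoint T ∘L opShift w S)) z =
      starRingEnd ℂ (tr (tfShift z ∘L T)) * tr (tfShift z ∘L S) := by
  obtain ⟨κ, t, χ, η, ht, htsum, hχ, hη, hT⟩ := hT
  obtain ⟨ι, s, ψ, φ, hs, hsum, hψ, hφ, hS⟩ := hS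
  exact symplecticFourier_tr_adjoint_comp_opShift hs hsum hψ hφ hS ht htsum hχ hη hT z

/-- Normalise the indicator of the unit ball, whose measure is positive and finite, also for `d =
0`. -/
theorem exists_norm_eq_one (d : ℕ) : ∃ χ : L2 d, ‖χ‖ = 1 := by
  have h0 : volume (Metric.ball (0 : EuclideanSpace ℝ (Fin d)) 1) ≠ 0 :=
    (Metric.measure_ball_pos volume 0 one_pos).ne'
  have h1 : volume (Metric.ball (0 : EuclideanSpace ℝ (Fin d)) 1) ≠ ⊤ := measure_ball_lt_top.ne
  set f : L2 d := indicatorConstLp 2 measurableSet_ball h1 (1 : ℂ) with hf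
  have hne : ‖f‖ ≠ 0 := by
    rw [hf, norm_indicatorConstLp two_ne_zero ENNReal.ofNat_ne_top, norm_one, one_mul]
    exact (Real.rpow_pos_of_pos (ENNReal.toReal_pos h0 h1) _).ne'
  have hfn : f ≠ 0 := fun h => hne (by rw [h, norm_zero])
  exact ⟨(((‖f‖)⁻¹ : ℝ) : ℂ) • f, by
    rw [norm_smul, Complex.norm_real, norm_inv, norm_norm, inv_mul_cancel₀ hne]⟩

/-- There is a rank one operator whose Fourier-Wigner transform does not vanish at a given
point. -/
theorem exists_isTraceClass_tr_ne_zero (z : Phase d) :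
    ∃ T : L2 d →L[ℂ] L2 d, IsTraceClass T ∧ tr (tfShift z ∘L T) ≠ 0 := by
  obtain ⟨χ, hχ⟩ := exists_norm_eq_one d
  have ho : ∀ ξ : L2 d, ‖ξ‖ = 1 → Orthonormal ℂ fun _ : Unit => ξ := fun ξ hξ =>
    ⟨fun _ => hξ, fun i j h => (h (Subsingleton.elim i j)).elim⟩
  have h1 := ho χ hχ
  have h2 := ho (tfShift z χ) (by rw [norm_tfShift, hχ])
  have hs : ∀ _ : Unit, (0 : ℝ) < 1 := fun _ => one_pos
  have hsum : Summable fun _ : Unit => (1 : ℝ) := Summable.of_finite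
  have hT : ∀ ζ : L2 d, HasSum (fun _ : Unit => (((1 : ℝ) : ℂ) * inner ℂ (tfShift z χ) ζ) • χ)
      (InnerProductSpace.rankOne ℂ χ (tfShift z χ) ζ) := by
    intro ζ
    simp
  -- For `T = ⟨π(z)χ, ·⟩ χ` the trace of `π(z)T` is `⟨π(z)χ, π(z)χ⟩ = 1`.
  refine ⟨InnerProductSpace.rankOne ℂ χ (tfShift z χ),
    ⟨Unit, fun _ => 1, fun _ => χ, fun _ => tfShift z χ, hs, hsum, h1, h2, hT⟩, ?_⟩
  rw [tr_comp hs hsum h1 h2 hT]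
  simp [inner_self_eq_norm_sq_to_K, norm_tfShift, hχ]

theorem fourierWigner_neg_eq_zero_iff (S : L2 d →L[ℂ] L2 d) (z : Phase d) :
    fourierWigner S (-z) = 0 ↔ tr (tfShift z ∘L S) = 0 := by
  rw [fourierWigner, neg_neg, mul_eq_zero, or_iff_right (Complex.exp_ne_zero _)]

end Main

end QHA

end

theorem mainTheorem8 (d : ℕ) (S : QHA.L2 d →L[ℂ] QHA.L2 d) (hS : QHA.IsTraceClass S) :
    (∀ ρ ∈ QHA.traceFunctionals (QHA.L2 d),
      MeasureTheory.Integrable fun z : QHA.Phase d => ρ (QHA.opShift z S)) ∧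
    QHA.specAlpha S = closure ({z : QHA.Phase d | QHA.fourierWigner S (-z) = 0}ᶜ) := by
  refine ⟨fun ρ hρ => QHA.integrable_traceFunctional hS hρ, ?_⟩
  refine subset_antisymm (closure_minimal ?_ isClosed_closure) (closure_mono fun z hz => ?_)
  · refine Set.iUnion₂_subset ?_
    rintro f ⟨ρ, ⟨T, hT, rfl⟩, rfl⟩
    refine closure_mono fun z hz => ?_
    rw [Set.mem_ofPred_eq, QHA.symplecticFourier_traceFunctional hS hT] at hz
    rw [Set.mem_compl_iff, Set.mem_ofPred_eq, QHA.fourierWigner_neg_eq_zero_iff]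
    exact right_ne_zero_of_mul hz
  · rw [Set.mem_compl_iff, Set.mem_ofPred_eq, QHA.fourierWigner_neg_eq_zero_iff] at hz
    -- The witness may depend on `z`, since only membership in the union over all `T` is needed.
    obtain ⟨T, hT, hTz⟩ := QHA.exists_isTraceClass_tr_ne_zero z
    refine Set.mem_biUnion (x := fun w => QHA.tr (ContinuousLinearMap.adjoint T ∘L
      QHA.opShift w S)) ⟨_, ⟨T, hT, rfl⟩, rfl⟩ (subset_closure ?_)
    rw [Set.mem_ofPred_eq, QHA.symplecticFourier_traceFunctional hS hT]
    exact mul_ne_zero ((map_ne_zero _).2 hTz) hz
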